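/- Let $S$ be a semigroup whose set $E$ of idempotents is finite. A pair $\{e,f\}$ of elements of $E$ is called basic if $\{e,f\}\cap\{ef,fe\}\neq\varnothing$; in that case $e\ast f:=ef$ is again in $E$, and $\mathcal{E}=(E,\ast)$ is the (finite) biordered set of idempotents of $S$. Let $E^+$ be the free semigroup on $E$ and let $$\mathsf{IG}(\mathcal{E})=\langle\,\overline{E} : \overline{e}\,\overline{f}=\overline{e\ast f}\ \text{whenever } \{e,f\} \text{ is a basic pair}\,\rangle$$ be the free idempotent generated semigroup over $\mathcal{E}$; for $w\in E^+$ let $\overline{w}$ be the element of $\mathsf{IG}(\mathcal{E})$ that $w$ represents. An r-factorisation of $w\in E^+$ is a factorisation $w=w_1\cdots w_m$ ($m\ge 1$, $w_i\in E^+$) such that every $\overline{w_i}$ is a regular element of $\mathsf{IG}(\mathcal{E})$, i.e. $\overline{w_i}\,x\,\overline{w_i}=\overline{w_i}$ for some $x\in\mathsf{IG}(\mathcal{E})$. A factorisation $(p_1,\dots,p_m)$ of $w$ is coarser than a factorisation $(q_1,\dots,q_s)$ of $w$ if each $p_i$ is the product of the $i$-th block in some partition of $(q_1,\dots,q_s)$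 into $m$ non-empty consecutive blocks. An r-factorisation of $w$ is minimal if no other r-factorisation of $w$ is coarser than it. On non-empty finite sequences of words from $E^+$ define $(p_1,\dots,p_m)\approx(q_1,\dots,q_s)$ if $m=s$ and one of the following holds: (i) $\overline{p_i}=\overline{q_i}$ for some $1\le i\le m$, and $p_j=q_j$ for all $j\ne i$; (ii) $\overline{p_i}=\overline{q_ie}$ and $\overline{q_{i+1}}=\overline{ep_{i+1}}$ for some $1\le i<m$ and $e\in E$, and $p_j=q_j$ for all $j\notin\{i,i+1\}$; (iii) $\overline{q_i}=\overline{p_ie}$ and $\overline{p_{i+1}}=\overline{eq_{i+1}}$ for some $1\le i<m$ and $e\in E$, and $p_j=q_j$ for all $j\notin\{i,i+1\}$. Let $\sim$ be the transitive closure of $\approx$. Theorem. For all $u,v\in E^+$ the following conditions are equivalent: (1) $\overline{u}=\overline{v}$ in $\mathsf{IG}(\mathcal{E})$; (2) there exist minimal r-factorisations $u=p_1\cdots p_m$ and $v=q_1\cdots q_m$ with the same number $m\ge 1$ of factors such that $(p_1,\dots,p_m)\sim(q_1,\dots,q_m)$; (3) there exists an integer $m\ge 1$ such that all minimal r-factorisations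 of $u$ and of $v$ have precisely $m$ factors, and whenever $u=p_1\cdots p_m$ and $v=q_1\cdots q_m$ are minimal r-factorisations, $(p_1,\dots,p_m)\sim(q_1,\dots,q_m)$. -/

import Mathlib

/-!
Call an element of `IG(E)¹` *seeded* if it is `𝓓`-related to a generator, that is, if it is spelled
by some word `x e y` with a letter `e` such that `x e 𝓛 e 𝓡 e y`. Having such a letter, a *seed*,
is invariant under the defining relations: when `e f` is replaced by `e ∗ f` inside a word, one of
the letters `e` and `f` is a seed exactly if `e ∗ f` is one. So every word for a seeded element has
a seed. If `a b` is seeded, its seed lies in `a` or in `b`; hence `a` is seeded and `a 𝓡 a b`, or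
`b` is seeded and `b 𝓛 a b`.

Call a sequence of seeded words *reduced* if no two neighbours have a seeded product. Then a product
of two or more consecutive factors is never seeded, and two reduced sequences spelling the same word
differ by moving letters between neighbours inside their `𝓡`- and `𝓛`-classes. As a defining
relation can be applied inside a single factor, the same holds, up to replacing factors by equal
ones, for reduced sequences spelling equal elements. Comparing the reductions of `w` and `w w` for
idempotent `w` then shows that the regular elements of `IG(E)` are the seeded ones, and it follows
that the minimal r-factorisations are the reduced sequences.
-/

namespace FreeIG

/-- The set `E` of idempotents of a semigroup `S`. -/
abbrev Idem (S : Type*) [Semigroup S] : Type _ := {e : S // IsIdempotentElem e}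

/-- `{e, f}` is a basic pair: `{e, f} ∩ {ef, fe} ≠ ∅`. -/
def BasicPair {S : Type*} [Semigroup S] (e f : Idem S) : Prop :=
  (({e.1, f.1} : Set S) ∩ {e.1 * f.1, f.1 * e.1}).Nonempty

/-- The product in `S` of a basic pair is idempotent. -/
theorem BasicPair.isIdempotentElem_mul {S : Type*} [Semigroup S] {e f : Idem S}
    (h : BasicPair e f) : IsIdempotentElem (e.1 * f.1) := by
  obtain ⟨e, he⟩ := e
  obtain ⟨f, hf⟩ := f
  obtain ⟨x, hx, hx'⟩ := h
  simp only [Set.mem_insert_iff, Set.mem_singleton_iff] at hx hx'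
  simp only [IsIdempotentElem] at he hf ⊢
  rcases hx with rfl | rfl <;> rcases hx' with h | h
  · rw [← h, he]
  · calc x * f * (x * f) = x * (f * x) * f := by simp only [mul_assoc]
      _ = x * f := by rw [← h, he]
  · rw [← h, hf]
  · calc e * x * (e * x) = e * (x * e) * x := by simp only [mul_assoc]
      _ = e * x := by rw [← h, mul_assoc, hf]

/-- The partial operation `e ∗ f` of the biordered set of idempotents of `S`,
defined on basic pairs. -/
def BasicPair.star {S : Type*} [Semigroup S] {e f : Idem S} (h : BasicPair e f) : Idem S :=
  ⟨e.1 * f.1, h.isIdempotentElem_mul⟩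

/-- Words over `E`, that is, elements of the free semigroup `E⁺`. -/
abbrev Word (S : Type*) [Semigroup S] : Type _ := FreeSemigroup (Idem S)

/-- The defining relations of `IG(E)`: `e f = e ∗ f` for each basic pair `{e, f}`. -/
inductive DefRel (S : Type*) [Semigroup S] : Word S → Word S → Prop
  | basic {e f : Idem S} (h : BasicPair e f) :
      DefRel S (FreeSemigroup.of e * FreeSemigroup.of f) (FreeSemigroup.of h.star)

/-- The free idempotent generated semigroup over the biordered set of idempotents of `S`: the
quotient of `E⁺` by the congruence generated by the defining relations. -/
abbrev IG (S : Type*) [Semigroup S] : Type _ := (conGen (DefRel S)).Quotient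

/-- The natural homomorphism `w ↦ w̄` from `E⁺` onto `IG(E)`. -/
def bar {S : Type*} [Semigroup S] : Word S →ₙ* IG S where
  toFun w := (w : (conGen (DefRel S)).Quotient)
  map_mul' _ _ := rfl

/-- Regular elements of a semigroup (in the sense of von Neumann). -/
def IsRegularElement {T : Type*} [Semigroup T] (a : T) : Prop := ∃ x : T, a * x * a = a

/-- The list of letters of a word. -/
def letters {S : Type*} [Semigroup S] (w : Word S) : List (Idem S) := w.head :: w.tail

/-- `w = p₁ ⋯ pₘ` in `E⁺`. As `w` and all the `pᵢ` are nonempty words, `m ≥ 1` is automatic. -/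
def IsFactorisation {S : Type*} [Semigroup S] (p : List (Word S)) (w : Word S) : Prop :=
  (p.map letters).flatten = letters w

/-- An r-factorisation of `w`: every factor represents a regular element of `IG(E)`. -/
def IsRFactorisation {S : Type*} [Semigroup S] (p : List (Word S)) (w : Word S) : Prop :=
  IsFactorisation p w ∧ ∀ x ∈ p, IsRegularElement (bar x)

/-- `(p₁, …, pₘ) ⪯ (q₁, …, qₛ)`: the sequence `q` can be cut into `m` consecutive
(automatically nonempty) blocks such that `pᵢ` is the product of the `i`-th block. -/
def Coarser {S : Type*} [Semigroup S] (p q : List (Word S)) : Prop :=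
  ∃ blocks : List (List (Word S)),
    blocks.flatten = q ∧ List.Forall₂ (fun x block => IsFactorisation block x) p blocks

/-- A minimal r-factorisation of `w`: a minimal element, with respect to `⪯`, of the set of all
r-factorisations of `w`. -/
def IsMinRFactorisation {S : Type*} [Semigroup S] (p : List (Word S)) (w : Word S) : Prop :=
  IsRFactorisation p w ∧ ∀ q, IsRFactorisation q w → Coarser q p → q = p

/-- The relation `≈` on nonempty finite sequences of words. -/
inductive Approx {S : Type*} [Semigroup S] : List (Word S) → List (Word S) → Prop
  | replace (l r : List (Word S)) (a b : Word S) (h : bar a = bar b) :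
      Approx (l ++ a :: r) (l ++ b :: r)
  | moveRight (l r : List (Word S)) (a b c d : Word S) (e : Idem S)
      (h₁ : bar a = bar (c * FreeSemigroup.of e))
      (h₂ : bar d = bar (FreeSemigroup.of e * b)) :
      Approx (l ++ a :: b :: r) (l ++ c :: d :: r)
  | moveLeft (l r : List (Word S)) (a b c d : Word S) (e : Idem S)
      (h₁ : bar c = bar (a * FreeSemigroup.of e))
      (h₂ : bar b = bar (FreeSemigroup.of e * d)) :
      Approx (l ++ a :: b :: r) (l ++ c :: d :: r)

/-- The relation `∼`, the transitive closure of `≈`. -/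
def Sim {S : Type*} [Semigroup S] : List (Word S) → List (Word S) → Prop :=
  Relation.TransGen Approx

end FreeIG

namespace FreeIG

open MulOpposite

section Green

variable {M : Type*} [Monoid M] {a b c g : M}

/-- Green's relation `𝓡` on a monoid: equality of principal right ideals. In Mathlib `a ∣ b` means
`b ∈ a M`. -/
def GreenR (a b : M) : Prop := a ∣ b ∧ b ∣ a

/-- Green's relation `𝓛` on a monoid, encoded as `𝓡` of the opposite monoid. -/
def GreenL (a b : M) : Prop := GreenR (op a) (op b)

/-- Green's relation `𝓓 = 𝓡 ∘ 𝓛` on a monoid. -/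
def GreenD (a b : M) : Prop := ∃ c, GreenR a c ∧ GreenL c b

theorem GreenR.refl (a : M) : GreenR a a := ⟨dvd_refl a, dvd_refl a⟩

theorem GreenR.symm (h : GreenR a b) : GreenR b a := ⟨h.2, h.1⟩

theorem GreenR.trans (h : GreenR a b) (h' : GreenR b c) : GreenR a c :=
  ⟨h.1.trans h'.1, h'.2.trans h.2⟩

theorem GreenR.mul_left (h : GreenR a b) (c : M) : GreenR (c * a) (c * b) :=
  ⟨mul_dvd_mul_left c h.1, mul_dvd_mul_left c h.2⟩

theorem equivalence_greenR : Equivalence (GreenR (M := M)) := ⟨.refl, .symm, .trans⟩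

theorem greenR_mul_right_iff : GreenR a (a * b) ↔ ∃ c, a * b * c = a :=
  ⟨fun h => h.2.imp fun _ hc => hc.symm, fun ⟨c, hc⟩ => ⟨dvd_mul_right a b, c, hc.symm⟩⟩

theorem GreenR.of_mul (h : GreenR a (a * (b * c))) : GreenR a (a * b) :=
  ⟨dvd_mul_right a b, (Dvd.intro c (mul_assoc a b c)).trans h.2⟩

theorem GreenL.refl (a : M) : GreenL a a := GreenR.refl (op a)

theorem GreenL.symm (h : GreenL a b) : GreenL b a := GreenR.symm h

theorem GreenL.trans (h : GreenL a b) (h' : GreenL b c) : GreenL a c := GreenR.trans h h'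

theorem equivalence_greenL : Equivalence (GreenL (M := M)) := ⟨.refl, .symm, .trans⟩

theorem GreenL.mul_right (h : GreenL a b) (c : M) : GreenL (a * c) (b * c) :=
  GreenR.mul_left h (op c)

theorem greenL_mul_left_iff : GreenL a (b * a) ↔ ∃ c, c * (b * a) = a :=
  greenR_mul_right_iff.trans ⟨fun ⟨c, hc⟩ => ⟨unop c, op_injective hc⟩,
    fun ⟨c, hc⟩ => ⟨op c, unop_injective hc⟩⟩

theorem GreenL.of_mul (h : GreenL c (a * b * c)) : GreenL c (b * c) :=
  GreenR.of_mul (a := op c) (b := op b) (c := op a) h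

theorem GreenL.exists_eq_mul (h : GreenL a b) : ∃ c, b = c * a :=
  h.1.elim fun c hc => ⟨unop c, op_injective hc⟩

theorem GreenR.trans_greenD (h : GreenR a b) (h' : GreenD b c) : GreenD a c :=
  h'.imp fun _ hd => ⟨h.trans hd.1, hd.2⟩

theorem GreenL.trans_greenD (h : GreenL a b) (h' : GreenD b c) : GreenD a c := by
  obtain ⟨_, ⟨⟨t, rfl⟩, hb⟩, hL⟩ := h'
  obtain ⟨x, rfl⟩ := h.symm.exists_eq_mul
  refine ⟨x * b * t, ?_, (h.mul_right t).trans hL⟩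
  rw [mul_assoc]
  exact GreenR.mul_left ⟨dvd_mul_right b t, hb⟩ x

theorem greenD_iff :
    GreenD a g ↔ ∃ x y, x * g * y = a ∧ GreenL g (x * g) ∧ GreenR g (g * y) := by
  constructor
  · rintro ⟨c, hR, hL⟩
    obtain ⟨x, rfl⟩ := hL.symm.exists_eq_mul
    obtain ⟨y, rfl⟩ := hR.2
    obtain ⟨r, hr⟩ := hL.exists_eq_mul
    refine ⟨x, y, rfl, hL.symm, ?_⟩
    have hrR := hR.symm.mul_left r
    rwa [← mul_assoc r (x * g) y, ← hr] at hrR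
  · rintro ⟨x, y, rfl, hL, hR⟩
    refine ⟨x * g, ?_, hL.symm⟩
    rw [mul_assoc]
    exact hR.symm.mul_left x

theorem GreenD.exists_mul_mul_eq (h : GreenD a g) (hg : IsIdempotentElem g) :
    ∃ x, a * x * a = a := by
  obtain ⟨x, y, rfl, hL, hR⟩ := greenD_iff.1 h
  obtain ⟨r, hr⟩ := greenL_mul_left_iff.1 hL
  obtain ⟨t, ht⟩ := greenR_mul_right_iff.1 hR
  refine ⟨t * r, ?_⟩
  calc x * g * y * (t * r) * (x * g * y) = x * (g * y * t) * (r * (x * g)) * y := by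
        simp only [mul_assoc]
    _ = x * g * y := by rw [hr, ht, mul_assoc x, hg.eq]

end Green

section Word

variable {S : Type*} [Semigroup S] {e f : Idem S}

/-- The class of a word in the monoid `IG(E)¹`, where Green's relations are computed. -/
def val (w : Word S) : WithOne (IG S) := bar w

/-- The generator `ē` of `IG(E)¹`. -/
def gen (e : Idem S) : WithOne (IG S) := val (FreeSemigroup.of e)

/-- The element of `IG(E)¹` spelled by a possibly empty list of letters. -/
def eval (l : List (Idem S)) : WithOne (IG S) := (l.map gen).prod

theorem val_mul (a b : Word S) : val (a * b) = val a * val b := by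
  simp only [val, map_mul, WithOne.coe_mul]

theorem val_eq_iff {a b : Word S} : val a = val b ↔ bar a = bar b := WithOne.coe_inj

@[simp] theorem eval_nil : eval ([] : List (Idem S)) = 1 := rfl

@[simp] theorem eval_cons (e : Idem S) (l : List (Idem S)) :
    eval (e :: l) = gen e * eval l := by simp [eval]

@[simp] theorem eval_append (l l' : List (Idem S)) : eval (l ++ l') = eval l * eval l' := by
  simp [eval]

@[simp] theorem letters_of (e : Idem S) : letters (FreeSemigroup.of e) = [e] := rfl

@[simp] theorem letters_mul (a b : Word S) : letters (a * b) = letters a ++ letters b := rfl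

theorem letters_ne_nil (w : Word S) : letters w ≠ [] := by simp [letters]

theorem letters_injective : Function.Injective (letters (S := S)) := by
  rintro ⟨a, l⟩ ⟨b, l'⟩ h
  simpa [letters] using h

theorem exists_letters_eq {l : List (Idem S)} (h : l ≠ []) : ∃ w : Word S, letters w = l := by
  cases l with
  | nil => exact absurd rfl h
  | cons a l => exact ⟨⟨a, l⟩, rfl⟩

@[simp] theorem eval_letters (w : Word S) : eval (letters w) = val w := by
  induction w using FreeSemigroup.recOnMul with
  | ih1 x => simp [gen]
  | ih2 x y hx hy => rw [letters_mul, eval_append, hx, hy, val_mul]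

theorem eval_surjective : Function.Surjective (eval (S := S)) := by
  intro a
  induction a using WithOne.recOneCoe with
  | one => exact ⟨[], rfl⟩
  | coe a =>
    obtain ⟨w, rfl⟩ := Quotient.exists_rep a
    exact ⟨letters w, eval_letters w⟩

theorem gen_mul_gen (h : BasicPair e f) : gen e * gen f = gen h.star := by
  rw [gen, gen, ← val_mul]
  exact val_eq_iff.2 ((Con.eq _).2 (ConGen.Rel.of _ _ (.basic h)))

theorem gen_mul_gen_of_eq_left (h : e.1 * f.1 = e.1) : gen e * gen f = gen e := by
  have hb : BasicPair e f := ⟨e.1, by simp, by simp [h]⟩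
  rw [gen_mul_gen hb]
  exact congrArg gen (Subtype.ext h)

theorem gen_mul_gen_of_eq_right (h : e.1 * f.1 = f.1) : gen e * gen f = gen f := by
  have hb : BasicPair e f := ⟨f.1, by simp, by simp [h]⟩
  rw [gen_mul_gen hb]
  exact congrArg gen (Subtype.ext h)

theorem isIdempotentElem_gen (e : Idem S) : IsIdempotentElem (gen e) :=
  gen_mul_gen_of_eq_left e.2

theorem BasicPair.gen_mul_gen_mul_gen (h : BasicPair e f) :
    gen e * gen f * gen e = gen e ∨ gen f * gen e * gen f = gen f := by
  obtain ⟨x, hx, hx'⟩ := h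
  simp only [Set.mem_insert_iff, Set.mem_singleton_iff] at hx hx'
  rcases hx with rfl | rfl <;> rcases hx' with h | h
  · left; rw [gen_mul_gen_of_eq_left h.symm, isIdempotentElem_gen]
  · left; rw [mul_assoc, gen_mul_gen_of_eq_right h.symm, isIdempotentElem_gen]
  · right; rw [mul_assoc, gen_mul_gen_of_eq_right h.symm, isIdempotentElem_gen]
  · right; rw [gen_mul_gen_of_eq_left h.symm, isIdempotentElem_gen]

end Word

section Seed

variable {S : Type*} [Semigroup S] {e f : Idem S} {a b : WithOne (IG S)}

/-- An element of `IG(E)¹` is seeded if it is `𝓓`-related to a generator. These elements turn out to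
be the regular elements of `IG(E)`, but being seeded is easier to read off a word. -/
def IsSeeded (a : WithOne (IG S)) : Prop := ∃ e : Idem S, GreenD a (gen e)

theorem isSeeded_gen (e : Idem S) : IsSeeded (gen e) := ⟨e, gen e, .refl _, .refl _⟩

theorem GreenR.isSeeded_iff (h : GreenR a b) : IsSeeded a ↔ IsSeeded b :=
  exists_congr fun _ => ⟨h.symm.trans_greenD, h.trans_greenD⟩

theorem GreenL.isSeeded_iff (h : GreenL a b) : IsSeeded a ↔ IsSeeded b :=
  exists_congr fun _ => ⟨h.symm.trans_greenD, h.trans_greenD⟩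

/-- `HasSeedIn u v l` says that some letter `e` of `l = x e y` satisfies `u x e 𝓛 e 𝓡 e y v`. The
contexts `u` and `v` make the notion compatible with splitting `l`. -/
def HasSeedIn (u v : WithOne (IG S)) : List (Idem S) → Prop
  | [] => False
  | e :: l => GreenL (gen e) (u * gen e) ∧ GreenR (gen e) (gen e * (eval l * v)) ∨
      HasSeedIn (u * gen e) v l

theorem hasSeedIn_append {u v : WithOne (IG S)} {l l' : List (Idem S)} :
    HasSeedIn u v (l ++ l') ↔ HasSeedIn u (eval l' * v) l ∨ HasSeedIn (u * eval l) v l' := by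
  induction l generalizing u with
  | nil => simp [HasSeedIn]
  | cons e l ih => simp [HasSeedIn, ih, mul_assoc, or_assoc]

theorem hasSeedIn_pair_iff (h : BasicPair e f) {u v : WithOne (IG S)} :
    HasSeedIn u v [e, f] ↔ HasSeedIn u v [h.star] := by
  simp only [HasSeedIn, eval_cons, eval_nil, mul_one, one_mul, or_false, ← gen_mul_gen h]
  constructor
  · rintro (⟨hL, hR⟩ | ⟨hL, hR⟩)
    · refine ⟨by simpa only [mul_assoc] using hL.mul_right (gen f), ?_⟩
      simpa only [mul_assoc] using hR.of_mul.symm.trans hR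
    · refine ⟨?_, by simpa only [mul_assoc] using hR.mul_left (gen e)⟩
      simpa only [mul_assoc] using hL.of_mul.symm.trans hL
  · rintro ⟨hL, hR⟩
    rcases h.gen_mul_gen_mul_gen with hefe | hfef
    · left
      have hef : GreenR (gen e) (gen e * gen f) := greenR_mul_right_iff.2 ⟨_, hefe⟩
      refine ⟨?_, by simpa only [mul_assoc] using hef.trans hR⟩
      simpa only [mul_assoc u, hefe] using hL.mul_right (gen e)
    · right
      have hef : GreenL (gen f) (gen e * gen f) :=
        greenL_mul_left_iff.2 ⟨gen f, by rw [← mul_assoc, hfef]⟩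
      refine ⟨by simpa only [mul_assoc] using hef.trans hL, ?_⟩
      simpa only [← mul_assoc, hfef] using hR.mul_left (gen f)

theorem hasSeedIn_congr {x y : Word S} (h : bar x = bar y) (u v : WithOne (IG S)) :
    HasSeedIn u v (letters x) ↔ HasSeedIn u v (letters y) := by
  replace h : ConGen.Rel (DefRel S) x y := (Con.eq _).1 h
  induction h generalizing u v with
  | of _ _ h =>
    obtain ⟨h⟩ := h
    exact hasSeedIn_pair_iff h
  | refl => rfl
  | symm _ ih => exact (ih u v).symm
  | trans _ _ ih ih' => exact (ih u v).trans (ih' u v)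
  | @mul w x y z hwx hyz ih ih' =>
    have hval : val w = val x := val_eq_iff.2 ((Con.eq _).2 hwx)
    have hval' : val y = val z := val_eq_iff.2 ((Con.eq _).2 hyz)
    simp only [letters_mul, hasSeedIn_append, eval_letters, hval, hval', ih, ih']

theorem HasSeedIn.greenR {u v : WithOne (IG S)} {l : List (Idem S)} (h : HasSeedIn u v l) :
    GreenR (u * eval l) (u * (eval l * v)) := by
  induction l generalizing u with
  | nil => exact h.elim
  | cons e l ih =>
    simp only [eval_cons, mul_assoc]
    rcases h with ⟨-, hR⟩ | h
    · exact (hR.of_mul.symm.trans hR).mul_left u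
    · simpa only [mul_assoc] using ih h

theorem HasSeedIn.greenL {u v : WithOne (IG S)} {l : List (Idem S)} (h : HasSeedIn u v l) :
    GreenL (eval l * v) (u * (eval l * v)) := by
  induction l generalizing u with
  | nil => exact h.elim
  | cons e l ih =>
    rw [eval_cons, mul_assoc, ← mul_assoc u]
    rcases h with ⟨hL, -⟩ | h
    · exact hL.mul_right (eval l * v)
    · exact (ih h).of_mul.symm.trans (ih h)

theorem HasSeedIn.isSeeded {u v : WithOne (IG S)} {l : List (Idem S)} (h : HasSeedIn u v l) :
    IsSeeded (u * eval l * v) := by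
  induction l generalizing u with
  | nil => exact h.elim
  | cons e l ih =>
    rcases h with ⟨hL, hR⟩ | h
    · exact ⟨e, greenD_iff.2 ⟨u, eval l * v, by simp only [eval_cons, mul_assoc], hL, hR⟩⟩
    · simpa only [eval_cons, mul_assoc] using ih h

theorem hasSeedIn_one_iff {l : List (Idem S)} : HasSeedIn 1 1 l ↔ IsSeeded (eval l) := by
  refine ⟨fun h => by simpa using h.isSeeded, fun ⟨e, h⟩ => ?_⟩
  obtain ⟨x, y, hxy, hL, hR⟩ := greenD_iff.1 h
  obtain ⟨lx, rfl⟩ := eval_surjective x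
  obtain ⟨ly, rfl⟩ := eval_surjective y
  obtain ⟨w', hw'⟩ := exists_letters_eq (l := lx ++ e :: ly) (by simp)
  have hval : eval l = val w' := by rw [← eval_letters, hw', ← hxy]; simp [mul_assoc]
  have hl : l ≠ [] := by
    rintro rfl
    exact WithOne.coe_ne_one hval.symm
  obtain ⟨w, rfl⟩ := exists_letters_eq hl
  rw [eval_letters, val_eq_iff] at hval
  rw [hasSeedIn_congr hval, hw', hasSeedIn_append]
  exact .inr (.inl (by simpa using ⟨hL, hR⟩))

theorem not_isSeeded_one : ¬ IsSeeded (1 : WithOne (IG S)) :=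
  fun h => hasSeedIn_one_iff (l := []).2 h

theorem IsSeeded.of_mul (h : IsSeeded (a * b)) :
    IsSeeded a ∧ GreenR a (a * b) ∨ IsSeeded b ∧ GreenL b (a * b) := by
  obtain ⟨l, rfl⟩ := eval_surjective a
  obtain ⟨l', rfl⟩ := eval_surjective b
  have hseed := h
  rw [← eval_append, ← hasSeedIn_one_iff, hasSeedIn_append, one_mul, mul_one] at hseed
  rcases hseed with hseed | hseed
  · have hR : GreenR (eval l) (eval l * eval l') := by simpa using hseed.greenR
    exact .inl ⟨hR.isSeeded_iff.2 h, hR⟩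
  · have hL : GreenL (eval l') (eval l * eval l') := by simpa using hseed.greenL
    exact .inr ⟨hL.isSeeded_iff.2 h, hL⟩

end Seed

section Reduced

variable {S : Type*} [Semigroup S] {a b : Word S} {p q : List (Word S)}

/-- The list of letters of the product of a sequence of words, so that `IsFactorisation p w` is
`spell p = letters w`. -/
def spell (p : List (Word S)) : List (Idem S) := (p.map letters).flatten

@[simp] theorem spell_nil : spell ([] : List (Word S)) = [] := rfl

@[simp] theorem spell_cons (a : Word S) (p : List (Word S)) :
    spell (a :: p) = letters a ++ spell p := rfl

@[simp] theorem spell_append (p q : List (Word S)) : spell (p ++ q) = spell p ++ spell q := by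
  simp [spell]

theorem spell_eq_nil_iff : spell p = [] ↔ p = [] := by
  cases p <;> simp [letters_ne_nil]

/-- A sequence of words is reduced if each word is seeded, but the product of two neighbours never
is. The minimal r-factorisations turn out to be the reduced ones. -/
structure IsReduced (p : List (Word S)) : Prop where
  isSeeded : ∀ x ∈ p, IsSeeded (val x)
  isChain : p.IsChain fun x y => ¬ IsSeeded (val x * val y)

theorem IsReduced.of_infix (h : IsReduced p) (hqp : q <:+: p) : IsReduced q :=
  ⟨fun x hx => h.isSeeded x (hqp.subset hx), h.isChain.infix hqp⟩

theorem IsReduced.tail (h : IsReduced (a :: p)) : IsReduced p :=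
  h.of_infix (List.suffix_cons a p).isInfix

theorem IsReduced.isSeeded_head (h : IsReduced (a :: p)) : IsSeeded (val a) :=
  h.isSeeded a List.mem_cons_self

theorem IsReduced.not_isSeeded_mul (h : IsReduced (a :: b :: p)) : ¬ IsSeeded (val a * val b) :=
  (List.isChain_cons_cons.1 h.isChain).1

theorem IsReduced.not_greenR (h : IsReduced (a :: b :: p)) :
    ¬ GreenR (val a) (val a * val b) :=
  fun hR => h.not_isSeeded_mul (hR.isSeeded_iff.1 h.isSeeded_head)

theorem IsReduced.not_greenL (h : IsReduced (a :: b :: p)) :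
    ¬ GreenL (val b) (val a * val b) :=
  fun hL => h.not_isSeeded_mul (hL.isSeeded_iff.1 h.tail.isSeeded_head)

theorem IsReduced.not_isSeeded_eval_spell (h : IsReduced p) (hp : 2 ≤ p.length) :
    ¬ IsSeeded (eval (spell p)) := by
  induction p with
  | nil => simp at hp
  | cons a p ih =>
    obtain _ | ⟨b, p⟩ := p
    · simp at hp
    intro hs
    rw [spell_cons, eval_append, eval_letters] at hs
    rcases hs.of_mul with ⟨-, hR⟩ | ⟨hs', hL⟩
    · rw [spell_cons, eval_append, eval_letters] at hR
      exact h.not_greenR hR.of_mul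
    · obtain _ | ⟨c, p⟩ := p
      · exact h.not_greenL (by simpa using hL)
      · exact ih h.tail (by simp) hs'

theorem IsReduced.not_greenL_prefix {c z : List (Idem S)} (h : IsReduced (a :: p))
    (hcz : spell p = c ++ z) (hc : IsSeeded (eval c)) : ¬ GreenL (eval c) (val a * eval c) := by
  induction p generalizing a c with
  | nil =>
    obtain ⟨rfl, -⟩ := List.append_eq_nil_iff.1 hcz.symm
    exact absurd hc not_isSeeded_one
  | cons b p ih =>
    intro hL
    rcases List.append_eq_append_iff.1 hcz with ⟨c', rfl, hp⟩ | ⟨d, hb, -⟩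
    · rw [eval_append, eval_letters] at hc hL
      rcases hc.of_mul with ⟨-, hR⟩ | ⟨hc', hL'⟩
      · obtain ⟨t, ht⟩ := greenR_mul_right_iff.1 hR
        refine h.not_greenL ?_
        simpa only [mul_assoc (val a), ht] using hL.mul_right t
      · exact ih h.tail hp hc' hL'
    · refine h.not_greenL ?_
      rw [← eval_letters b, hb, eval_append, ← mul_assoc]
      exact hL.mul_right (eval d)

/-- An elementary move between sequences of words: replace a factor by an equal one, or transfer a
word `c` from a factor to its left neighbour without leaving the `𝓡`-class of the left one and the
`𝓛`-class of the right one. -/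
inductive Slide : List (Word S) → List (Word S) → Prop
  | replace (l r : List (Word S)) {a b : Word S} (h : val a = val b) :
      Slide (l ++ a :: r) (l ++ b :: r)
  | transfer (l r : List (Word S)) {a b a' b' : Word S} {c : List (Idem S)}
      (ha : letters a' = letters a ++ c) (hb : letters b = c ++ letters b')
      (hR : GreenR (val a) (val a')) (hL : GreenL (val b) (val b')) :
      Slide (l ++ a :: b :: r) (l ++ a' :: b' :: r)

/-- The equivalence relation generated by slides. -/
def Linked : List (Word S) → List (Word S) → Prop := Relation.EqvGen Slide

theorem Slide.linked (h : Slide p q) : Linked p q := .rel p q h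

theorem Slide.isReduced (h : Slide p q) (hp : IsReduced p) : IsReduced q := by
  obtain ⟨hs, hc⟩ := hp
  cases h with
  | replace l r h =>
    constructor
    · simpa only [List.forall_mem_append, List.forall_mem_cons, h] using hs
    · simpa [h, List.isChain_append, List.isChain_cons] using hc
  | @transfer l r a b a' b' c ha hb hR hL =>
    have hmul : val a * val b = val a' * val b' := by
      rw [← eval_letters b, hb, ← eval_letters a', ha]
      simp [mul_assoc]
    have hl (x : WithOne (IG S)) : IsSeeded (x * val a) ↔ IsSeeded (x * val a') :=
      (hR.mul_left x).isSeeded_iff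
    have hr (x : WithOne (IG S)) : IsSeeded (val b * x) ↔ IsSeeded (val b' * x) :=
      (hL.mul_right x).isSeeded_iff
    constructor
    · simpa only [List.forall_mem_append, List.forall_mem_cons, hR.isSeeded_iff,
        hL.isSeeded_iff] using hs
    · simpa [hmul, hl, hr, List.isChain_append_cons_cons, List.isChain_append, List.isChain_cons]
        using hc

theorem Linked.of_equivalence {r : List (Word S) → List (Word S) → Prop} (hr : Equivalence r)
    (h : ∀ p q, Slide p q → r p q) (hpq : Linked p q) : r p q :=
  hr.eqvGen_iff.1 (Relation.EqvGen.mono h _ _ hpq)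

theorem Linked.length_eq (h : Linked p q) : p.length = q.length := by
  refine h.of_equivalence (r := fun p q => p.length = q.length) (eq_equivalence.comap _) ?_
  rintro _ _ (_ | _) <;> simp

theorem Linked.cons (a : Word S) (h : Linked p q) : Linked (a :: p) (a :: q) := by
  refine h.of_equivalence (r := fun p q => Linked (a :: p) (a :: q))
    ((Relation.EqvGen.is_equivalence _).comap (a :: ·)) ?_
  rintro _ _ (⟨l, r, h⟩ | ⟨l, r, ha, hb, hR, hL⟩)
  · exact (Slide.replace (a :: l) r h).linked
  · exact (Slide.transfer (a :: l) r ha hb hR hL).linked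

theorem Linked.greenR_head (h : Linked (a :: p) (b :: q)) : GreenR (val a) (val b) := by
  refine h.of_equivalence (equivalence_greenR.comap fun p => (p.map val).headD 1) ?_
  rintro _ _ (⟨_ | _, r, h⟩ | ⟨_ | _, r, ha, hb, hR, hL⟩)
  · simpa [Function.onFun, h] using GreenR.refl _
  · exact .refl _
  · exact hR
  · exact .refl _

theorem Linked.greenL_getLast (h : Linked (p ++ [a]) (q ++ [b])) : GreenL (val a) (val b) := by
  suffices h : GreenL (((p ++ [a]).map val).getLastD 1) (((q ++ [b]).map val).getLastD 1) by
    simpa using h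
  refine h.of_equivalence (equivalence_greenL.comap fun p => (p.map val).getLastD 1) ?_
  rintro _ _ (⟨l, _ | _, h⟩ | ⟨l, _ | _, ha, hb, hR, hL⟩)
  · simpa [Function.onFun, h] using GreenL.refl _
  · simpa [Function.onFun] using GreenL.refl _
  · simpa [Function.onFun] using hL
  · simpa [Function.onFun] using GreenL.refl _

theorem IsReduced.exists_slide {p₁ q₁ : Word S} {c z : List (Idem S)}
    (hp : IsReduced (p₁ :: p)) (hq₁ : IsSeeded (val q₁)) (hc : letters q₁ = letters p₁ ++ c)
    (hcz : spell p = c ++ z) :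
    ∃ q, IsReduced (q₁ :: q) ∧ spell q = z ∧ Linked (p₁ :: p) (q₁ :: q) := by
  have hval : val q₁ = val p₁ * eval c := by
    rw [← eval_letters, hc, eval_append, eval_letters]
  have hR : GreenR (val p₁) (val p₁ * eval c) := by
    rcases (hval ▸ hq₁).of_mul with ⟨-, hR⟩ | ⟨hs, hL⟩
    · exact hR
    · exact absurd hL (hp.not_greenL_prefix hcz hs)
  rcases eq_or_ne c [] with rfl | hc'
  · obtain rfl : q₁ = p₁ := letters_injective (by simpa using hc)
    exact ⟨p, hp, hcz, .refl _⟩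
  obtain _ | ⟨p₂, p⟩ := p
  · exact absurd (List.append_eq_nil_iff.1 hcz.symm).1 hc'
  rcases List.append_eq_append_iff.1 hcz with ⟨c', rfl, -⟩ | ⟨d, hp₂, rfl⟩
  · rw [eval_append, eval_letters] at hR
    exact absurd hR.of_mul hp.not_greenR
  have hval₂ : val p₂ = eval c * eval d := by rw [← eval_letters, hp₂, eval_append]
  obtain ⟨hd, hL⟩ : IsSeeded (eval d) ∧ GreenL (eval d) (val p₂) := by
    rcases (hval₂ ▸ hp.tail.isSeeded_head).of_mul with ⟨-, hR'⟩ | h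
    · refine absurd (hR.trans (hR'.mul_left (val p₁))) ?_
      rw [← hval₂]
      exact hp.not_greenR
    · rwa [hval₂]
  obtain ⟨q₂, rfl⟩ := exists_letters_eq (l := d) (by
    rintro rfl
    exact not_isSeeded_one hd)
  rw [eval_letters] at hL
  have hslide : Slide (p₁ :: p₂ :: p) (q₁ :: q₂ :: p) :=
    .transfer [] p hc hp₂ (hval ▸ hR) hL.symm
  exact ⟨q₂ :: p, hslide.isReduced hp, rfl, hslide.linked⟩

theorem IsReduced.linked (hp : IsReduced p) (hq : IsReduced q) (h : spell p = spell q) :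
    Linked p q := by
  induction hn : p.length generalizing p q with
  | zero =>
    obtain rfl := List.length_eq_zero_iff.1 hn
    obtain rfl := spell_eq_nil_iff.1 h.symm
    exact .refl _
  | succ n ih =>
    obtain ⟨p₁, p, rfl⟩ := List.exists_cons_of_length_eq_add_one hn
    obtain _ | ⟨q₁, q⟩ := q
    · exact absurd (spell_eq_nil_iff.1 h) (List.cons_ne_nil p₁ p)
    rw [List.length_cons, Nat.add_right_cancel_iff] at hn
    rcases List.append_eq_append_iff.1 h with ⟨c, hc, hcz⟩ | ⟨c, hc, hcz⟩
    · obtain ⟨p', hp', hp'q, hlink⟩ := hp.exists_slide hq.isSeeded_head hc hcz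
      have hn' : p'.length = n := by simpa [hn] using hlink.length_eq.symm
      exact hlink.trans _ _ _ ((ih hp'.tail hq.tail hp'q hn').cons q₁)
    · obtain ⟨q', hq', hq'p, hlink⟩ := hq.exists_slide hp.isSeeded_head hc hcz
      exact ((ih hp.tail hq'.tail hq'p.symm hn).cons p₁).trans _ _ _ (hlink.symm _ _)

end Reduced

section Existence

variable {S : Type*} [Semigroup S] {p q : List (Word S)}

/-- Absorb neighbours into `b` for as long as the product is seeded. -/
theorem IsReduced.exists_insert {b : Word S} {l r : List (Word S)} (hl : IsReduced l)
    (hr : IsReduced r) (hb : IsSeeded (val b)) :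
    ∃ l' m m' r' c, l = l' ++ m ∧ r = m' ++ r' ∧ letters c = spell m ++ letters b ++ spell m' ∧
      IsReduced (l' ++ c :: r') := by
  by_cases hL : ∃ a ∈ l.getLast?, IsSeeded (val a * val b)
  · obtain ⟨a, ha, hab⟩ := hL
    obtain ⟨l, rfl⟩ := List.getLast?_eq_some_iff.1 ha
    obtain ⟨l', m, m', r', c, rfl, rfl, hc, hred⟩ :=
      IsReduced.exists_insert (b := a * b) (hl.of_infix (List.prefix_append l [a]).isInfix) hr
        (val_mul a b ▸ hab)
    exact ⟨l', m ++ [a], m', r', c, by simp, rfl, by simpa using hc, hred⟩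
  by_cases hR : ∃ a ∈ r.head?, IsSeeded (val b * val a)
  · obtain ⟨a, ha, hba⟩ := hR
    obtain ⟨r, rfl⟩ := List.head?_eq_some_iff.1 ha
    obtain ⟨l', m, m', r', c, rfl, rfl, hc, hred⟩ :=
      IsReduced.exists_insert (b := b * a) hl hr.tail (val_mul b a ▸ hba)
    exact ⟨l', m, a :: m', r', c, rfl, rfl, by simpa using hc, hred⟩
  refine ⟨l, [], [], r, b, by simp, by simp, by simp, ?_, ?_⟩
  · simpa only [List.forall_mem_append, List.forall_mem_cons]
      using ⟨hl.isSeeded, hb, hr.isSeeded⟩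
  · push Not at hL hR
    simpa [List.isChain_append, List.isChain_cons] using ⟨hl.isChain, ⟨hR, hr.isChain⟩, hL⟩
termination_by l.length + r.length

theorem exists_isReduced (w : List (Idem S)) : ∃ p, IsReduced p ∧ spell p = w := by
  induction w with
  | nil => exact ⟨[], ⟨by simp, .nil⟩, rfl⟩
  | cons e w ih =>
    obtain ⟨p, hp, rfl⟩ := ih
    obtain ⟨l', m, m', r', c, hl, rfl, hc, hred⟩ :=
      IsReduced.exists_insert (l := []) ⟨by simp, .nil⟩ hp (isSeeded_gen e)
    obtain ⟨rfl, rfl⟩ := List.append_eq_nil_iff.1 hl.symm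
    exact ⟨c :: r', hred, by simp [hc]⟩

theorem exists_of_spell_eq_append_cons {x y : List (Idem S)} {e : Idem S}
    (h : spell p = x ++ e :: y) :
    ∃ l a r x₁ y₁, p = l ++ a :: r ∧ letters a = x₁ ++ e :: y₁ ∧ x = spell l ++ x₁ ∧
      y = y₁ ++ spell r := by
  induction p generalizing x with
  | nil => simp at h
  | cons a p ih =>
    rcases List.append_eq_append_iff.1 h with ⟨z, rfl, hz⟩ | ⟨_ | ⟨d, z⟩, ha, hz⟩
    · obtain ⟨l, b, r, x₁, y₁, rfl, hb, rfl, rfl⟩ := ih hz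
      exact ⟨a :: l, b, r, x₁, y₁, rfl, hb, by simp, rfl⟩
    · obtain ⟨l, b, r, x₁, y₁, rfl, hb, hl, rfl⟩ := ih (x := []) hz.symm
      exact ⟨a :: l, b, r, x₁, y₁, rfl, hb, by simp_all, rfl⟩
    · obtain ⟨rfl, rfl⟩ := List.cons.inj hz
      exact ⟨[], a, p, x, z, rfl, ha, rfl, rfl⟩

theorem IsReduced.linked_of_bar_eq_in_context {u v : Word S} {x y : List (Idem S)}
    (huv : bar u = bar v) (hp : IsReduced p) (hq : IsReduced q)
    (hpu : spell p = x ++ letters u ++ y) (hqv : spell q = x ++ letters v ++ y) :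
    Linked p q := by
  replace huv : ConGen.Rel (DefRel S) u v := (Con.eq _).1 huv
  induction huv generalizing x y p q with
  | of _ _ h =>
    obtain @⟨e, f, h⟩ := h
    obtain ⟨l, b, r, x₁, y₁, rfl, hb, rfl, rfl⟩ := exists_of_spell_eq_append_cons (p := q)
      (by simpa using hqv)
    obtain ⟨b', hb'⟩ := exists_letters_eq (l := x₁ ++ e :: f :: y₁) (by simp)
    have hval : val b = val b' := by
      rw [← eval_letters, hb, ← eval_letters, hb']
      simp [← gen_mul_gen h, mul_assoc]
    have hslide : Slide (l ++ b :: r) (l ++ b' :: r) := .replace l r hval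
    refine (hp.linked (hslide.isReduced hq) ?_).trans _ _ _ (hslide.linked.symm _ _)
    simp [hpu, hb']
  | refl u => exact hp.linked hq (hpu.trans hqv.symm)
  | symm _ ih => exact (ih hq hp hqv hpu).symm _ _
  | @trans u v w _ _ ih ih' =>
    obtain ⟨m, hm, hmv⟩ := exists_isReduced (x ++ letters v ++ y)
    exact (ih hp hm hpu hmv).trans _ _ _ (ih' hm hq hmv hqv)
  | @mul u u' v v' _ _ ih ih' =>
    obtain ⟨m, hm, hmv⟩ := exists_isReduced (x ++ letters u' ++ (letters v ++ y))
    exact (ih hp hm (by simpa using hpu) hmv).trans _ _ _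
      (ih' (x := x ++ letters u') hm hq (by simpa using hmv) (by simpa using hqv))

theorem IsReduced.linked_of_bar_eq {u v : Word S} (hp : IsReduced p) (hq : IsReduced q)
    (hpu : spell p = letters u) (hqv : spell q = letters v) (huv : bar u = bar v) : Linked p q :=
  hp.linked_of_bar_eq_in_context (x := []) (y := []) huv hq (by simpa using hpu)
    (by simpa using hqv)

end Existence

section Regular

variable {S : Type*} [Semigroup S] {w a : Word S} {p : List (Word S)}

theorem IsReduced.eq_nil_of_greenR {u : WithOne (IG S)} (h : IsReduced (a :: p))
    (hR : GreenR (val a) (val a * (eval (spell p) * u))) : p = [] := by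
  obtain _ | ⟨b, p⟩ := p
  · rfl
  · rw [spell_cons, eval_append, eval_letters, mul_assoc] at hR
    exact absurd hR.of_mul h.not_greenR

theorem IsReduced.eq_nil_of_greenL {u : WithOne (IG S)} (h : IsReduced (p ++ [a]))
    (hL : GreenL (val a) (u * eval (spell p) * val a)) : p = [] := by
  rcases List.eq_nil_or_concat' p with rfl | ⟨p, b, rfl⟩
  · rfl
  · have hba : IsReduced [b, a] := h.of_infix (List.IsSuffix.isInfix ⟨p, by simp⟩)
    rw [spell_append, eval_append, spell_cons, spell_nil, List.append_nil, eval_letters,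
      ← mul_assoc] at hL
    exact absurd hL.of_mul hba.not_greenL

theorem IsReduced.eq_nil_of_linked {c : Word S} {l m m' r : List (Word S)}
    (hp : IsReduced (l ++ m ++ [a])) (hm' : l ++ m ++ [a] = m' ++ r)
    (hc : val c = eval (spell (m ++ [a])) * eval (spell m')) (hs : IsSeeded (val c))
    (hlink : Linked (l ++ m ++ [a]) (l ++ c :: r)) : l = [] ∧ m = [] := by
  have hmr : m.length = r.length := by simpa using hlink.length_eq
  have hlm' : l.length + 1 = m'.length := by
    have hlen := congrArg List.length hm'
    simp only [List.length_append, List.length_singleton] at hlen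
    lia
  rw [hc] at hs
  rcases hs.of_mul with ⟨hs, -⟩ | ⟨hs, -⟩
  · obtain rfl : m = [] := by
      by_contra hm
      refine IsReduced.not_isSeeded_eval_spell (p := m ++ [a])
        (hp.of_infix (List.IsSuffix.isInfix ⟨l, by simp⟩)) ?_ hs
      simpa [Nat.one_le_iff_ne_zero] using hm
    obtain rfl := List.length_eq_zero_iff.1 hmr.symm
    rw [List.append_nil] at hp hm' hlink
    rw [List.append_nil] at hm'
    have hL := hlink.greenL_getLast
    rw [hc, ← hm'] at hL
    exact ⟨hp.eq_nil_of_greenL (u := val a) (by simpa [mul_assoc] using hL), rfl⟩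
  · obtain rfl : l = [] := by
      by_contra hl
      refine IsReduced.not_isSeeded_eval_spell (p := m')
        (hp.of_infix (List.IsPrefix.isInfix ⟨r, hm'.symm⟩)) ?_ hs
      rw [← hlm']
      simpa [Nat.one_le_iff_ne_zero] using hl
    obtain ⟨x, rfl⟩ := List.length_eq_one_iff.1 hlm'.symm
    simp only [List.nil_append, List.singleton_append] at hp hm' hlink
    rw [hm'] at hp hlink hc
    have hR := hlink.greenR_head
    obtain rfl := hp.eq_nil_of_greenR (u := val x) (by simpa [hc, mul_assoc] using hR)
    exact ⟨rfl, List.length_eq_zero_iff.1 hmr⟩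

/-- Compare a reduced `p` spelling `w` with the reduction of `p p`, which spells `w w`: they are
linked and so have equally many factors. Merging at the junction of the two copies must therefore
halve the number of factors, but a product of two or more neighbours is never seeded. -/
theorem isSeeded_of_isIdempotentElem (hw : IsIdempotentElem (bar w)) : IsSeeded (val w) := by
  obtain ⟨p, hp, hpw⟩ := exists_isReduced (letters w)
  rcases List.eq_nil_or_concat' p with rfl | ⟨p, a, rfl⟩
  · exact absurd hpw.symm (letters_ne_nil w)
  obtain ⟨l, m, m', r, c, rfl, hm', hc, hq⟩ := IsReduced.exists_insert
    (hp.of_infix (List.prefix_append p [a]).isInfix) hp (hp.isSeeded a (by simp))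
  have hlink : Linked (l ++ m ++ [a]) (l ++ c :: r) := by
    refine hp.linked_of_bar_eq hq hpw (v := w * w) ?_ (by rw [map_mul, hw])
    rw [letters_mul, ← hpw]
    nth_rewrite 2 [hm']
    simp [hc]
  have hval : val c = eval (spell (m ++ [a])) * eval (spell m') := by
    rw [← eval_letters, hc]
    simp [mul_assoc]
  obtain ⟨rfl, rfl⟩ := hp.eq_nil_of_linked hm' hval (hq.isSeeded c (by simp)) hlink
  rw [← eval_letters, ← hpw]
  simpa using hp.isSeeded_head

theorem isRegularElement_iff : IsRegularElement (bar w) ↔ IsSeeded (val w) := by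
  constructor
  · rintro ⟨x, hx⟩
    obtain ⟨x, rfl⟩ := Quotient.exists_rep x
    have hval : val w * val x * val w = val w := congrArg WithOne.coe hx
    have hidem : IsIdempotentElem (bar (w * x)) := by
      rw [IsIdempotentElem, map_mul, ← mul_assoc]
      exact congrArg (· * bar x) hx
    have hR : GreenR (val w) (val (w * x)) := by
      rw [val_mul]
      exact greenR_mul_right_iff.2 ⟨_, hval⟩
    exact hR.isSeeded_iff.2 (isSeeded_of_isIdempotentElem hidem)
  · rintro ⟨e, h⟩
    obtain ⟨x, hx⟩ := h.exists_mul_mul_eq (isIdempotentElem_gen e)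
    induction x using WithOne.recOneCoe with
    | one =>
      rw [mul_one] at hx
      exact ⟨bar w, WithOne.coe_injective ((congrArg (· * val w) hx).trans hx)⟩
    | coe x => exact ⟨x, WithOne.coe_injective hx⟩

end Regular

section Minimal

variable {S : Type*} [Semigroup S] {w : Word S} {p q : List (Word S)}

theorem isFactorisation_iff : IsFactorisation p w ↔ spell p = letters w := Iff.rfl

theorem coarser_merge (l r : List (Word S)) (a b : Word S) :
    Coarser (l ++ (a * b) :: r) (l ++ a :: b :: r) := by
  have hself (l : List (Word S)) :
      List.Forall₂ (fun x block => IsFactorisation block x) l (l.map fun x => [x]) := by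
    rw [List.forall₂_map_right_iff, List.forall₂_same]
    exact fun x _ => by simp [isFactorisation_iff]
  refine ⟨l.map (fun x => [x]) ++ [a, b] :: r.map fun x => [x], ?_,
    List.rel_append (hself l) (.cons ?_ (hself r))⟩
  · simp [← List.flatMap_def]
  · simp [isFactorisation_iff]

theorem IsMinRFactorisation.isReduced (h : IsMinRFactorisation p w) : IsReduced p := by
  obtain ⟨⟨hpw, hreg⟩, hmin⟩ := h
  refine ⟨fun x hx => isRegularElement_iff.1 (hreg x hx),
    List.isChain_iff_forall_rel_of_append_cons_cons.2 ?_⟩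
  rintro a b l r rfl hab
  have hmerge : IsRFactorisation (l ++ (a * b) :: r) w := by
    refine ⟨?_, ?_⟩
    · rw [isFactorisation_iff] at hpw ⊢
      simpa using hpw
    · simp only [List.forall_mem_append, List.forall_mem_cons] at hreg ⊢
      exact ⟨hreg.1, isRegularElement_iff.2 (val_mul a b ▸ hab), hreg.2.2.2⟩
  simpa using congrArg List.length (hmin _ hmerge (coarser_merge l r a b))

theorem IsReduced.eq_of_coarser (hp : IsReduced p) (hq : ∀ x ∈ q, IsSeeded (val x))
    (h : Coarser q p) : q = p := by
  obtain ⟨blocks, rfl, h⟩ := h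
  induction h with
  | nil => rfl
  | @cons x block q blocks hx _ ih =>
    rw [isFactorisation_iff] at hx
    rw [List.forall_mem_cons] at hq
    rw [List.flatten_cons] at hp
    obtain rfl := ih hq.2 (hp.of_infix (List.suffix_append block blocks.flatten).isInfix)
    obtain _ | ⟨a, _ | ⟨b, block⟩⟩ := block
    · exact absurd hx.symm (letters_ne_nil x)
    · obtain rfl : a = x := letters_injective (by simpa using hx)
      rfl
    · refine absurd hq.1 ?_
      rw [← eval_letters, ← hx]
      exact (hp.of_infix (List.prefix_append _ _).isInfix).not_isSeeded_eval_spell (by simp)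

theorem isMinRFactorisation_iff :
    IsMinRFactorisation p w ↔ IsReduced p ∧ spell p = letters w := by
  refine ⟨fun h => ⟨h.isReduced, h.1.1⟩, fun ⟨hp, hpw⟩ => ⟨⟨hpw, fun x hx => ?_⟩,
    fun q hq hqp => hp.eq_of_coarser (fun x hx => ?_) hqp⟩⟩
  · exact isRegularElement_iff.2 (hp.isSeeded x hx)
  · exact isRegularElement_iff.1 (hq.2 x hx)

theorem exists_isMinRFactorisation (w : Word S) : ∃ p, IsMinRFactorisation p w := by
  simpa only [isMinRFactorisation_iff] using exists_isReduced (letters w)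

theorem IsMinRFactorisation.ne_nil (h : IsMinRFactorisation p w) : p ≠ [] := by
  rintro rfl
  exact letters_ne_nil w h.1.1.symm

theorem IsMinRFactorisation.linked {u v : Word S} (hp : IsMinRFactorisation p u)
    (hq : IsMinRFactorisation q v) (h : bar u = bar v) : Linked p q :=
  hp.isReduced.linked_of_bar_eq hq.isReduced hp.1.1 hq.1.1 h

end Minimal

section Sim

variable {S : Type*} [Semigroup S] {p q : List (Word S)}

theorem Approx.symm (h : Approx p q) : Approx q p := by
  cases h with
  | replace l r a b h => exact .replace l r b a h.symm
  | moveRight l r a b c d e h₁ h₂ => exact .moveLeft l r c d a b e h₁ h₂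
  | moveLeft l r a b c d e h₁ h₂ => exact .moveRight l r c d a b e h₁ h₂

theorem Approx.eval_spell_eq (h : Approx p q) : eval (spell p) = eval (spell q) := by
  cases h with
  | replace l r a b h => simp [val_eq_iff.2 h]
  | moveRight l r a b c d e h₁ h₂ =>
    simp [val_eq_iff.2 h₁, val_eq_iff.2 h₂, val_mul, mul_assoc]
  | moveLeft l r a b c d e h₁ h₂ =>
    simp [val_eq_iff.2 h₁, val_eq_iff.2 h₂, val_mul, mul_assoc]

theorem Sim.eval_spell_eq (h : Sim p q) : eval (spell p) = eval (spell q) := by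
  induction h with
  | single h => exact h.eval_spell_eq
  | tail _ h ih => exact ih.trans h.eval_spell_eq

theorem reflTransGen_approx_transfer (l r : List (Word S)) {a b a' b' : Word S}
    {c : List (Idem S)} (ha : letters a' = letters a ++ c) (hb : letters b = c ++ letters b') :
    Relation.ReflTransGen Approx (l ++ a :: b :: r) (l ++ a' :: b' :: r) := by
  induction c generalizing a b with
  | nil =>
    obtain rfl : a' = a := letters_injective (by simpa using ha)
    obtain rfl : b = b' := letters_injective hb
    exact .refl
  | cons e c ih =>
    obtain ⟨d, hd⟩ := exists_letters_eq (l := c ++ letters b') (by simp [letters_ne_nil])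
    have hbd : b = .of e * d := letters_injective (by simp [hb, hd])
    have hmove : Approx (l ++ a :: b :: r) (l ++ (a * .of e) :: d :: r) :=
      .moveLeft l r a b (a * .of e) d e rfl (congrArg bar hbd)
    exact .head hmove (ih (by simpa using ha) hd)

theorem Linked.reflTransGen_approx (h : Linked p q) : Relation.ReflTransGen Approx p q := by
  have : Std.Symm (Approx (S := S)) := ⟨fun _ _ h => h.symm⟩
  refine h.of_equivalence ⟨fun _ => .refl, fun h => Std.Symm.symm _ _ h, .trans⟩ ?_
  rintro _ _ (⟨l, r, h⟩ | ⟨l, r, ha, hb, -, -⟩)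
  · exact .single (.replace l r _ _ (val_eq_iff.1 h))
  · exact reflTransGen_approx_transfer l r ha hb

theorem Linked.sim (h : Linked p q) (hp : p ≠ []) : Sim p q := by
  obtain _ | ⟨a, p⟩ := p
  · exact absurd rfl hp
  · exact .head' (.replace [] p a a rfl) h.reflTransGen_approx

end Sim

end FreeIG

open FreeIG in
theorem mainTheorem2_general {S : Type*} [Semigroup S] (u v : Word S) :
    List.TFAE
      [bar u = bar v,
        ∃ p q : List (Word S),
          IsMinRFactorisation p u ∧ IsMinRFactorisation q v ∧ p.length = q.length ∧ Sim p q,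
        ∃ m : ℕ, 1 ≤ m ∧
          (∀ p, IsMinRFactorisation p u → p.length = m) ∧
          (∀ q, IsMinRFactorisation q v → q.length = m) ∧
          ∀ p q, IsMinRFactorisation p u → IsMinRFactorisation q v → Sim p q] := by
  obtain ⟨p₀, hp₀⟩ := exists_isMinRFactorisation u
  obtain ⟨q₀, hq₀⟩ := exists_isMinRFactorisation v
  tfae_have 1 → 3 := fun huv =>
    ⟨p₀.length, List.length_pos_iff.2 hp₀.ne_nil, fun p hp => (hp.linked hp₀ rfl).length_eq,
      fun q hq => (hq.linked hp₀ huv.symm).length_eq,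
      fun p q hp hq => (hp.linked hq huv).sim hp.ne_nil⟩
  tfae_have 3 → 2 := fun ⟨m, _, hu, hv, hsim⟩ =>
    ⟨p₀, q₀, hp₀, hq₀, (hu p₀ hp₀).trans (hv q₀ hq₀).symm, hsim p₀ q₀ hp₀ hq₀⟩
  tfae_have 2 → 1 := by
    rintro ⟨p, q, hp, hq, -, hsim⟩
    have hval : val u = val v := by
      rw [← eval_letters u, ← eval_letters v, ← (isMinRFactorisation_iff.1 hp).2,
        ← (isMinRFactorisation_iff.1 hq).2, hsim.eval_spell_eq]
    exact val_eq_iff.1 hval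
  tfae_finish

theorem mainTheorem2 {S : Type*} [Semigroup S] [Finite (FreeIG.Idem S)]
    (u v : FreeIG.Word S) :
    List.TFAE
      [FreeIG.bar u = FreeIG.bar v,
        ∃ p q : List (FreeIG.Word S),
          FreeIG.IsMinRFactorisation p u ∧ FreeIG.IsMinRFactorisation q v ∧
            p.length = q.length ∧ FreeIG.Sim p q,
        ∃ m : ℕ, 1 ≤ m ∧
          (∀ p, FreeIG.IsMinRFactorisation p u → p.length = m) ∧
          (∀ q, FreeIG.IsMinRFactorisation q v → q.length = m) ∧
          ∀ p q, FreeIG.IsMinRFactorisation p u → FreeIG.IsMinRFactorisation q v →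
            FreeIG.Sim p q] :=
  mainTheorem2_general u v
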